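/- For a function $g\in L^2(\mathbb R)$ and $a,b>0$ let $\mathcal G(g,a,b)=\{e^{2\pi i b m\,\cdot}\,g(\cdot-ak)\}_{k,m\in\mathbb Z}$. Let $B_2=B_1*B_1$ with $B_1=\chi_{[-1/2,1/2]}$, so $B_2(x)=\max(0,1-|x|)$. Suppose $ab=\frac56$ and $b\in[\frac73,\frac83]$. Then: 1. The Gabor system $\mathcal G(B_2,a,b)$ is not a frame for $L^2(\mathbb R)$, i.e. there are no constants $0<A\le B<\infty$ with $A\|f\|^2\le\sum_{k,m\in\mathbb Z}|\langle f,e^{2\pi i bm\,\cdot}B_2(\cdot-ak)\rangle|^2\le B\|f\|^2$ for all $f\in L^2(\mathbb R)$. 2. Let $\Psi=\Psi^{B_2}(0,0)$ be the value at $(x,\nu)=(0,0)$ of the $5\times6$ matrix with entries $$\Psi^{B_2}(x,\nu)_{k,\ell}=b^{-1/2}\sum_{n\in\mathbb Z}B_2\bigl(x+6an+a\ell+\tfrac kb\bigr)e^{-2\pi i\,6an\nu},\qquad k=0,\dots,4,\ \ell=0,\dots,5,$$ and let $R_1,\dots,R_5$ be the rows of $\Psi$, so that $R_i$ is the row with $k=i-1$.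 Then $R_2-R_5=\frac53\,(R_3-R_4)$, and $\Psi$ has rank less than $5$. 3. There are no coprime $p,q\in\mathbb N$ with $ab=\frac pq$ and $|b-R(b)|\le\frac1{2q}$, where $R(b)=\lfloor b+\frac12\rfloor$ is the integer nearest to $b$. (It is known that $\mathcal G(B_2,a,b)$ is not a frame when $b>\frac32$ and such $p,q$ exist; so the parameters above are not covered by that family.) -/

import Mathlib

open MeasureTheory

namespace GaborFrames

/-- A family `f` in a complex Hilbert space `H` is a frame for `H` if there are constants
`0 < A, B < ∞` with `A ‖x‖² ≤ ∑ |⟨x, f i⟩|² ≤ B ‖x‖²` for all `x` in `H`. -/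
def IsFrame {ι H : Type*} [NormedAddCommGroup H] [InnerProductSpace ℂ H] (f : ι → H) : Prop :=
  ∃ A B : ℝ, 0 < A ∧ 0 < B ∧ ∀ x : H,
    Summable (fun i => ‖inner ℂ (f i) x‖ ^ 2) ∧
    A * ‖x‖ ^ 2 ≤ ∑' i, ‖inner ℂ (f i) x‖ ^ 2 ∧
    ∑' i, ‖inner ℂ (f i) x‖ ^ 2 ≤ B * ‖x‖ ^ 2

/-- The time-frequency shift `x ↦ exp (2π i b m x) g (x - a k)`. -/
noncomputable def atom (g : ℝ → ℂ) (a b : ℝ) (k m : ℤ) (x : ℝ) : ℂ :=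
  Complex.exp (2 * Real.pi * Complex.I * b * m * x) * g (x - a * k)

theorem memLp_atom {g : ℝ → ℂ} (hg : MemLp g 2 volume) (a b : ℝ) (k m : ℤ) :
    MemLp (atom g a b k m) 2 volume := by
  have h := hg.comp_measurePreserving (measurePreserving_sub_right volume (a * k))
  have hm : AEStronglyMeasurable (atom g a b k m) volume := by
    refine AEStronglyMeasurable.mul ?_ h.1
    exact Continuous.aestronglyMeasurable (by fun_prop)
  refine h.of_le hm (Filter.Eventually.of_forall fun x => ?_)
  have he : ‖Complex.exp (2 * Real.pi * Complex.I * b * m * x)‖ = 1 := by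
    have : (2 * Real.pi * Complex.I * b * m * x : ℂ)
        = ((2 * Real.pi * b * m * x : ℝ) : ℂ) * Complex.I := by
      push_cast; ring
    rw [this, Complex.norm_exp_ofReal_mul_I]
  simp [atom, he]

/-- The Gabor system `𝒢(g, a, b)` in `L²(ℝ)`, indexed by the pairs `(k, m)` of integers. -/
noncomputable def gaborSystem (g : ℝ → ℂ) (hg : MemLp g 2 volume) (a b : ℝ) :
    ℤ × ℤ → Lp ℂ 2 (volume : Measure ℝ) :=
  fun i => (memLp_atom hg a b i.1 i.2).toLp (atom g a b i.1 i.2)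

/-- The B-splines: `B 1` is the indicator function of `[-1/2, 1/2]` and
`B (n + 1) = B n ∗ B 1` for `n ≥ 1`. The value at the index `0` is a dummy. -/
noncomputable def B : ℕ → ℝ → ℝ
  | 0 => 0
  | 1 => Set.indicator (Set.Icc (-1 / 2) (1 / 2)) 1
  | n + 2 => convolution (B (n + 1)) (Set.indicator (Set.Icc (-1 / 2) (1 / 2)) 1)
      (ContinuousLinearMap.mul ℝ ℝ) volume

theorem B_integrable_bounded (n : ℕ) :
    Integrable (B n) volume ∧ ∃ C : ℝ, ∀ x, ‖B n x‖ ≤ C := by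
  have hi : Integrable (Set.indicator (Set.Icc (-1 / 2 : ℝ) (1 / 2)) (1 : ℝ → ℝ)) volume :=
    (integrable_indicator_iff measurableSet_Icc).2
      (continuousOn_const.integrableOn_compact isCompact_Icc)
  have hb : ∀ x, ‖Set.indicator (Set.Icc (-1 / 2 : ℝ) (1 / 2)) (1 : ℝ → ℝ) x‖ ≤ 1 := by
    intro x
    refine (norm_indicator_le_norm_self _ _).trans ?_
    simp
  induction n using Nat.twoStepInduction with
  | zero => exact ⟨integrable_zero _ _ _, 0, by simp [B]⟩
  | one => exact ⟨hi, 1, hb⟩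
  | more n _ ih =>
    obtain ⟨hI, -⟩ := ih
    refine ⟨hI.integrable_convolution _ hi, ∫ t, ‖B (n + 1) t‖, fun x => ?_⟩
    refine norm_integral_le_of_norm_le hI.norm (Filter.Eventually.of_forall fun t => ?_)
    simp only [ContinuousLinearMap.mul_apply', norm_mul]
    exact mul_le_of_le_one_right (norm_nonneg _) (hb _)

/-- `B n` belongs to `L²(ℝ)`. -/
theorem memLp_B (n : ℕ) : MemLp (fun x => (B n x : ℂ)) 2 volume := by
  obtain ⟨hI, C, hC⟩ := B_integrable_bounded n
  refine (memLp_two_iff_integrable_sq_norm hI.ofReal.1).2 ?_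
  refine (hI.norm.const_mul C).mono' (hI.ofReal.1.norm.pow 2) (Filter.Eventually.of_forall fun x => ?_)
  simp only [Complex.norm_real, Real.norm_eq_abs, sq, norm_mul, abs_abs]
  exact mul_le_mul_of_nonneg_right (hC x) (abs_nonneg _)

/-- The Zibulski–Zeevi type `p × q` matrix `Ψ(x, ν)` of `𝒢(g, a, b)`, for `a b = p / q`, with entries
`b ^ (-1/2) ∑ₙ g (x + a q n + a ℓ + k / b) exp (-2π i a q n ν)`, where the row index `k` and the
column index `ℓ` start at `0`. -/
noncomputable def zzMatrix (g : ℝ → ℂ) (a b : ℝ) (p q : ℕ) (x ν : ℝ) :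
    Matrix (Fin p) (Fin q) ℂ :=
  Matrix.of fun k l => ((Real.sqrt b)⁻¹ : ℝ) *
    ∑' n : ℤ, g (x + a * q * n + a * (l : ℕ) + (k : ℕ) / b) *
      Complex.exp (-(2 * Real.pi * Complex.I * a * q * n * ν))

end GaborFrames

/-!
With `t = 1/b ∈ [3/8, 3/7]` and `a = 5 t / 6`, the entries of `Ψ(0, 0)` are sums of values of the
hat function `B 2` (`B_two`) at points `q t` with `6 q` an integer. The hypothesis on `b` says that
`|q| t ≤ 1` for `|q| ≤ 7/3` and `|q| t ≥ 1` for `|q| ≥ 8/3`, and no point with `7/3 < |q| < 8/3`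
occurs in rows `1` to `4`, so the entries of these rows are explicit affine functions of `t`, and
the row relation is checked column by column (`zzMatrix_hat_row_relation`). It says that
`(0, 1, -5/3, 5/3, -1)` is in the left kernel of `Ψ(0, 0)`, so that the rank is less than `5`.

The failure of the lower frame bound is a consequence of this rank deficiency at a single point,
because the hat function is Lipschitz. Extend the null vector to a `5`-periodic sequence
`nullCoeff` on `ℤ`; then `∑ j, nullCoeff j * hat (j t - a k) = 0` for every integer `k`
(`sum_nullCoeff_mul_hat`). Let the test function take the value `nullCoeff j` on `(j t, j t + δ]`
for `0 ≤ j < 5 N` and vanish elsewhere, with `δ = t / N`. Its squared norm is at least `N δ`. By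
Parseval's identity on an interval of length `t` (`hasSum_norm_integral_exp_mul_sq`), the part of
the frame sum that belongs to the translate by `a k` is `t` times the integral over `[0, δ]` of the
square of `truncSum`, the truncation of the sum above with sample points shifted by `x ∈ [0, δ]`.
It vanishes for all but about `6 N` values of `k`. For those whose window meets an end of the
truncation range, which are boundedly many, `truncSum` is bounded; for all others it is `O(δ)`. So
the frame sum is `O(δ)` uniformly in `N` (`tsum_norm_inner_testFun_le`), which contradicts a lower
bound `A N δ` when `N` is large.
-/

namespace GaborFrames

/-! ### The hat function -/

/-- The hat function `x ↦ max 0 (1 - |x|)`, the closed form of the B-spline `B 2`. -/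
noncomputable def hat (x : ℝ) : ℝ := max 0 (1 - |x|)

theorem B_two (x : ℝ) : B 2 x = hat x := by
  have h : B 2 x = ∫ t, (Set.Icc (-1 / 2 : ℝ) (1 / 2) ∩ Set.Icc (x - 1 / 2) (x + 1 / 2)).indicator
      (1 : ℝ → ℝ) t := by
    simp only [B, convolution]
    refine integral_congr_ae (Filter.Eventually.of_forall fun t => ?_)
    have hm : x - t ∈ Set.Icc (-1 / 2 : ℝ) (1 / 2) ↔ t ∈ Set.Icc (x - 1 / 2) (x + 1 / 2) := by
      simp only [Set.mem_Icc]
      constructor <;> rintro ⟨h₁, h₂⟩ <;> constructor <;> linarith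
    by_cases h₁ : t ∈ Set.Icc (-1 / 2 : ℝ) (1 / 2) <;>
      by_cases h₂ : t ∈ Set.Icc (x - 1 / 2) (x + 1 / 2) <;>
      simp only [Set.indicator, ContinuousLinearMap.mul_apply', Set.mem_inter_iff, hm, h₁, h₂] <;>
      simp
  rw [h, Set.Icc_inter_Icc, integral_indicator_one measurableSet_Icc, Real.volume_real_Icc, hat]
  rcases le_total 0 x with hx | hx
  · rw [abs_of_nonneg hx, min_eq_left (by linarith : (1 / 2 : ℝ) ≤ x + 1 / 2),
      max_eq_right (by linarith : (-1 / 2 : ℝ) ≤ x - 1 / 2), max_comm]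
    ring_nf
  · rw [abs_of_nonpos hx, min_eq_right (by linarith : x + 1 / 2 ≤ (1 / 2 : ℝ)),
      max_eq_left (by linarith : x - 1 / 2 ≤ (-1 / 2 : ℝ)), max_comm]
    ring_nf

theorem hat_neg (x : ℝ) : hat (-x) = hat x := by simp [hat]

theorem hat_nonneg (x : ℝ) : 0 ≤ hat x := le_max_left _ _

theorem hat_le_one (x : ℝ) : hat x ≤ 1 :=
  max_le zero_le_one (by linarith [abs_nonneg x])

theorem hat_eq_zero {x : ℝ} (hx : 1 ≤ |x|) : hat x = 0 :=
  max_eq_left (by linarith)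

theorem abs_hat_sub_le (x y : ℝ) : |hat x - hat y| ≤ |x - y| := by
  refine (abs_max_sub_max_le_max _ _ _ _).trans (max_le (by simp) ?_)
  rw [show 1 - |x| - (1 - |y|) = -(|x| - |y|) by ring, abs_neg]
  exact abs_abs_sub_abs_le x y

theorem continuous_hat : Continuous hat := by
  unfold hat
  fun_prop

/-- For `t = 1/b` in `[3/8, 3/7]` the edge of the support of `x ↦ hat (x t)` is at
`|x| = b ∈ [7/3, 8/3]`, so `hat (q t)` is an affine function of `t` when `|q| ≤ 7/3` and vanishes
when `|q| ≥ 8/3`. -/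
theorem hat_mul_of_le {t : ℝ} (ht : t ∈ Set.Icc (3 / 8 : ℝ) (3 / 7)) {q : ℝ}
    (hq : |q| ≤ 7 / 3) : hat (q * t) = 1 - |q| * t := by
  rw [hat, abs_mul, abs_of_nonneg (by linarith [ht.1] : (0 : ℝ) ≤ t)]
  exact max_eq_right (by nlinarith [ht.1, ht.2])

theorem hat_mul_of_ge {t : ℝ} (ht : 3 / 8 ≤ t) {q : ℝ}
    (hq : 8 / 3 ≤ |q|) : hat (q * t) = 0 := by
  refine hat_eq_zero ?_
  rw [abs_mul, abs_of_nonneg (by linarith : (0 : ℝ) ≤ t)]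
  nlinarith

theorem inv_mem_Icc {b : ℝ} (hb : b ∈ Set.Icc (7 / 3 : ℝ) (8 / 3)) :
    b⁻¹ ∈ Set.Icc (3 / 8 : ℝ) (3 / 7) := by
  have hb0 : 0 < b := by linarith [hb.1]
  constructor
  · rw [le_inv_comm₀ (by norm_num) hb0]
    norm_num [hb.2]
  · rw [inv_le_comm₀ hb0 (by norm_num)]
    norm_num [hb.1]

/-! ### The null vector -/

/-- The `5`-periodic extension to `ℤ` of the vector `(0, 1, -5/3, 5/3, -1)` in the left kernel of
`Ψ(0, 0)`. -/
noncomputable def nullCoeff (j : ℤ) : ℝ :=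
  if j % 5 = 1 then 1 else if j % 5 = 2 then -5 / 3 else if j % 5 = 3 then 5 / 3
  else if j % 5 = 4 then -1 else 0

theorem nullCoeff_add_five_mul (u i : ℤ) : nullCoeff (5 * u + i) = nullCoeff i := by
  simp [nullCoeff]

theorem abs_nullCoeff_le (j : ℤ) : |nullCoeff j| ≤ 5 / 3 := by
  unfold nullCoeff
  split_ifs <;> norm_num [abs_of_pos, abs_of_neg]

/-- The row relation of `Ψ(0, 0)` as a sum over `j ∈ ℤ`: the periodic null vector annihilates the
samples of the hat function on every translate of `tℤ` by a multiple of `5 t / 6`. The index window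
`5 ⌊k / 6⌋ - 3 ≤ j ≤ 5 ⌊k / 6⌋ + 6` contains every `j` whose term is nonzero, with enough room for a
shift of the sample points by at most `t`. -/
theorem sum_nullCoeff_mul_hat {t : ℝ} (ht : t ∈ Set.Icc (3 / 8 : ℝ) (3 / 7)) (k : ℤ) :
    ∑ j ∈ Finset.Icc (5 * (k / 6) - 3) (5 * (k / 6) + 6),
      nullCoeff j * hat (j * t - 5 / 6 * t * k) = 0 := by
  -- Periodicity in `j` modulo `5` reduces the claim to the residues `k = 0, …, 5`.
  have hI : Finset.Icc (5 * (k / 6) - 3) (5 * (k / 6) + 6)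
      = (Finset.Icc (-3) 6).map (addLeftEmbedding (5 * (k / 6))) := by
    rw [Finset.map_add_left_Icc]
    rfl
  have hS : (Finset.Icc (-3) 6 : Finset ℤ) = {-3, -2, -1, 0, 1, 2, 3, 4, 5, 6} := by decide
  have hk : (k : ℝ) = 6 * (k / 6 : ℤ) + (k % 6 : ℤ) := by
    exact_mod_cast (Int.mul_ediv_add_emod k 6).symm
  have harg (i : ℤ) : ((5 * (k / 6) + i : ℤ) : ℝ) * t - 5 / 6 * t * k
      = (i - 5 / 6 * (k % 6 : ℤ)) * t := by
    rw [hk]; push_cast; ring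
  rw [hI, Finset.sum_map]
  simp only [addLeftEmbedding_apply, nullCoeff_add_five_mul, harg]
  have h₀ := Int.emod_nonneg k (by norm_num : (6 : ℤ) ≠ 0)
  have h₁ := Int.emod_lt_of_pos k (by norm_num : (0 : ℤ) < 6)
  generalize k % 6 = r at h₀ h₁
  have h7 (q : ℝ) (hq : |q| ≤ 7 / 3) := hat_mul_of_le ht hq
  have h8 (q : ℝ) (hq : 8 / 3 ≤ |q|) := hat_mul_of_ge ht.1 hq
  have h1 : hat t = 1 - t := by simpa using h7 1 (by norm_num)
  rw [hS]
  interval_cases r <;>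
    norm_num [nullCoeff, hat_neg, h1, h7, h8, abs_of_pos] <;> ring

/-! ### The Zibulski–Zeevi matrix -/

/-- Only `n = -2, -1, 0` contribute to the series defining the entries, since the points
`(5 n + k + 5 ℓ / 6) / b` with other `n` lie outside the support of the hat function. -/
theorem zzMatrix_hat_apply {a b : ℝ} (hab : a * b = 5 / 6)
    (hb : b ∈ Set.Icc (7 / 3 : ℝ) (8 / 3)) (k : Fin 5) (l : Fin 6) :
    zzMatrix (fun x => (hat x : ℂ)) a b 5 6 0 0 k l =
      (((Real.sqrt b)⁻¹ * (hat ((k - 10 + 5 / 6 * l) * b⁻¹) + hat ((k - 5 + 5 / 6 * l) * b⁻¹)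
        + hat ((k + 5 / 6 * l) * b⁻¹)) : ℝ) : ℂ) := by
  have hb0 : 0 < b := by linarith [hb.1]
  have ha : a = 5 / 6 * b⁻¹ := by field_simp; linarith
  have ht := (inv_mem_Icc hb).1
  have harg (n : ℤ) : (0 : ℝ) + a * (6 : ℕ) * n + a * ((l : ℕ) : ℝ) + ((k : ℕ) : ℝ) / b
      = (5 * n + k + 5 / 6 * l) * b⁻¹ := by
    rw [ha]; push_cast; ring
  have hk : ((k : ℕ) : ℝ) ≤ 4 := by exact_mod_cast Nat.le_of_lt_succ k.2
  have hl : ((l : ℕ) : ℝ) ≤ 5 := by exact_mod_cast Nat.le_of_lt_succ l.2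
  have hk0 : (0 : ℝ) ≤ (k : ℕ) := Nat.cast_nonneg _
  have hl0 : (0 : ℝ) ≤ (l : ℕ) := Nat.cast_nonneg _
  simp only [zzMatrix, Matrix.of_apply, harg]
  rw [tsum_eq_sum (s := {-2, -1, 0})]
  · simp only [Finset.mem_insert, Finset.mem_singleton, Int.reduceNeg, neg_inj,
      OfNat.ofNat_ne_one, OfNat.ofNat_ne_zero, neg_eq_zero, one_ne_zero, or_self,
      not_false_eq_true, Finset.sum_insert, Finset.sum_singleton]
    push_cast
    ring_nf
    simp
  · intro n hn
    have hn' : n ≤ -3 ∨ 1 ≤ n := by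
      simp only [Finset.mem_insert, Finset.mem_singleton] at hn
      omega
    rw [hat_mul_of_ge ht, Complex.ofReal_zero, zero_mul]
    rcases hn' with h | h
    · have : (n : ℝ) ≤ -3 := by exact_mod_cast h
      exact le_abs.2 (Or.inr (by linarith))
    · have : (1 : ℝ) ≤ n := by exact_mod_cast h
      exact le_abs.2 (Or.inl (by linarith))

theorem zzMatrix_hat_row_relation {a b : ℝ} (hab : a * b = 5 / 6)
    (hb : b ∈ Set.Icc (7 / 3 : ℝ) (8 / 3)) :
    (zzMatrix (fun x => (hat x : ℂ)) a b 5 6 0 0).row 1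
        - (zzMatrix (fun x => (hat x : ℂ)) a b 5 6 0 0).row 4 =
      (5 / 3 : ℂ) • ((zzMatrix (fun x => (hat x : ℂ)) a b 5 6 0 0).row 2
        - (zzMatrix (fun x => (hat x : ℂ)) a b 5 6 0 0).row 3) := by
  have ht := inv_mem_Icc hb
  have h7 (q : ℝ) (hq : |q| ≤ 7 / 3) := hat_mul_of_le ht hq
  have h8 (q : ℝ) (hq : 8 / 3 ≤ |q|) := hat_mul_of_ge ht.1 hq
  have h1 : hat b⁻¹ = 1 - b⁻¹ := by simpa using h7 1 (by norm_num)
  ext l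
  simp only [Matrix.row, Pi.sub_apply, Pi.smul_apply, smul_eq_mul, zzMatrix_hat_apply hab hb]
  rw [show (5 / 3 : ℂ) = ((5 / 3 : ℝ) : ℂ) by push_cast; rfl]
  norm_cast
  fin_cases l <;>
    norm_num [hat_neg, h1, h7, h8, abs_of_pos] <;> ring

theorem rank_lt_five_of_row_relation {Ψ : Matrix (Fin 5) (Fin 6) ℂ}
    (h : Ψ.row 1 - Ψ.row 4 = (5 / 3 : ℂ) • (Ψ.row 2 - Ψ.row 3)) : Ψ.rank < 5 := by
  refine lt_of_le_of_ne (by simpa using Ψ.rank_le_height) fun h5 => ?_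
  have hli : LinearIndependent ℂ Ψ.row := by
    rw [linearIndependent_iff_card_eq_finrank_span, Set.finrank, ← Ψ.rank_eq_finrank_span_row, h5,
      Fintype.card_fin]
  have := Fintype.linearIndependent_iff.1 hli ![0, 1, -5 / 3, 5 / 3, -1] (by
    simp only [Fin.sum_univ_five]
    ext l
    have := congrFun h l
    simp at this ⊢
    linear_combination this) 1
  simp at this

/-- In lowest terms `a b = 5/6` forces `q = 6` (`q = 0` is excluded by `p / 0 = 0`), while the
distance from `b` to the nearest integer is at least `1/3 > 1/12`. -/
theorem not_exists_abs_sub_round_le {a b : ℝ} (hab : a * b = 5 / 6)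
    (hb : b ∈ Set.Icc (7 / 3 : ℝ) (8 / 3)) :
    ¬ ∃ p q : ℕ, p.Coprime q ∧ a * b = p / q ∧ |b - round b| ≤ 1 / (2 * (q : ℝ)) := by
  rintro ⟨p, q, hpq, h, hr⟩
  have hq0 : (q : ℝ) ≠ 0 := by
    rintro h0
    norm_num [hab, h0] at h
  have hq : 6 ≤ q := by
    have h6 : 5 * q = 6 * p := by
      rw [hab, div_eq_div_iff (by norm_num) hq0] at h
      have : (5 * q : ℝ) = 6 * p := by linarith
      exact_mod_cast this
    have : 6 ∣ 5 * q := ⟨p, h6⟩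
    have : 6 ∣ q := Nat.Coprime.dvd_of_dvd_mul_left (by norm_num) this
    exact Nat.le_of_dvd (Nat.pos_of_ne_zero (by exact_mod_cast hq0)) this
  have hq' : (6 : ℝ) ≤ q := by exact_mod_cast hq
  have h12 : |b - round b| ≤ 1 / 12 := by
    refine hr.trans ?_
    exact one_div_le_one_div_of_le (by norm_num) (by linarith)
  obtain ⟨h₁, h₂⟩ := abs_le.1 h12
  have : 2 < round b := by
    have : (2 : ℝ) < round b := by linarith [hb.1]
    exact_mod_cast this
  have : round b < 3 := by
    have : (round b : ℝ) < 3 := by linarith [hb.2]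
    exact_mod_cast this
  omega

/-! ### Sums of the truncated null vector against the window -/

/-- The `5`-periodic null vector, truncated to `0 ≤ j < 5 N`, summed against the samples of the
hat function at the points `x + j t - 5 t k / 6`. This is the `1/b`-periodization, for `t = 1/b`,
of the product of the test function with the translate of the window by `a k`. -/
noncomputable def truncSum (N : ℕ) (t : ℝ) (k : ℤ) (x : ℝ) : ℝ :=
  ∑ j ∈ Finset.Ico (0 : ℤ) (5 * N), nullCoeff j * hat (x + j * t - 5 / 6 * t * k)

theorem continuous_truncSum (N : ℕ) (t : ℝ) (k : ℤ) : Continuous (truncSum N t k) := by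
  unfold truncSum
  refine continuous_finsetSum _ fun j _ => continuous_const.mul (continuous_hat.comp ?_)
  fun_prop

/-- Samples outside the window vanish, also after a shift of the sample points by `x ∈ [0, t]`. -/
theorem hat_sample_eq_zero {t x : ℝ} (ht : 3 / 8 ≤ t) (hx : x ∈ Set.Icc 0 t) {j k : ℤ}
    (hj : j ∉ Finset.Icc (5 * (k / 6) - 3) (5 * (k / 6) + 6)) :
    hat (x + j * t - 5 / 6 * t * k) = 0 := by
  obtain ⟨hx0, hxt⟩ := hx
  refine hat_eq_zero (le_abs.2 ?_)
  rw [Finset.mem_Icc, not_and_or] at hj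
  rcases hj with h | h
  · right
    have h' : 6 * j + 24 ≤ 5 * k := by omega
    have h' : (6 * j + 24 : ℝ) ≤ 5 * k := by exact_mod_cast h'
    nlinarith
  · left
    have h' : 5 * k + 17 ≤ 6 * j := by omega
    have h' : (5 * k + 17 : ℝ) ≤ 6 * j := by exact_mod_cast h'
    nlinarith

theorem truncSum_eq_sum_inter {N : ℕ} {t x : ℝ} (ht : 3 / 8 ≤ t) (hx : x ∈ Set.Icc 0 t) (k : ℤ) :
    truncSum N t k x =
      ∑ j ∈ Finset.Ico (0 : ℤ) (5 * N) ∩ Finset.Icc (5 * (k / 6) - 3) (5 * (k / 6) + 6),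
        nullCoeff j * hat (x + j * t - 5 / 6 * t * k) := by
  refine (Finset.sum_subset Finset.inter_subset_left fun j hj hj' => ?_).symm
  rw [hat_sample_eq_zero ht hx fun h => hj' (Finset.mem_inter.2 ⟨hj, h⟩), mul_zero]

/-- For these `k` the window of relevant indices misses the truncation range `0 ≤ j < 5 N`. -/
theorem truncSum_eq_zero {N : ℕ} {t x : ℝ} (ht : 3 / 8 ≤ t) (hx : x ∈ Set.Icc 0 t) {k : ℤ}
    (hk : k ∉ Finset.Ico (-6 : ℤ) (6 * N + 6)) : truncSum N t k x = 0 := by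
  rw [truncSum_eq_sum_inter ht hx, Finset.sum_eq_zero]
  intro j hj
  simp only [Finset.mem_inter, Finset.mem_Ico, Finset.mem_Icc] at hj hk
  omega

/-- At most `10` terms, each bounded by `5/3`, are nonzero; `17` rounds up `50/3`. -/
theorem abs_truncSum_le {N : ℕ} {t x : ℝ} (ht : 3 / 8 ≤ t) (hx : x ∈ Set.Icc 0 t) (k : ℤ) :
    |truncSum N t k x| ≤ 17 := by
  rw [truncSum_eq_sum_inter ht hx]
  refine (Finset.abs_sum_le_sum_abs _ _).trans ?_
  refine (Finset.sum_le_card_nsmul _ _ (5 / 3) fun j _ => ?_).trans ?_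
  · rw [abs_mul, abs_of_nonneg (hat_nonneg _)]
    exact (mul_le_of_le_one_right (abs_nonneg _) (hat_le_one _)).trans (abs_nullCoeff_le j)
  · have h : (Finset.Ico (0 : ℤ) (5 * N) ∩
        Finset.Icc (5 * (k / 6) - 3) (5 * (k / 6) + 6)).card ≤ 10 := by
      refine (Finset.card_le_card Finset.inter_subset_right).trans ?_
      rw [Int.card_Icc]
      omega
    have h : ((Finset.Ico (0 : ℤ) (5 * N) ∩
        Finset.Icc (5 * (k / 6) - 3) (5 * (k / 6) + 6)).card : ℝ) ≤ 10 := by exact_mod_cast h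
    rw [nsmul_eq_mul]
    linarith

/-- Away from both ends of the truncation the sum vanishes at `x = 0`, so that it is `O(x)` by the
Lipschitz continuity of the hat function. -/
theorem abs_truncSum_le_mul {N : ℕ} {t x : ℝ} (ht : t ∈ Set.Icc (3 / 8 : ℝ) (3 / 7))
    (hx : x ∈ Set.Icc 0 t) {k : ℤ} (hk : k ∈ Finset.Ico (6 : ℤ) (6 * N - 6)) :
    |truncSum N t k x| ≤ 17 * x := by
  have hI : Finset.Ico (0 : ℤ) (5 * N) ∩ Finset.Icc (5 * (k / 6) - 3) (5 * (k / 6) + 6)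
      = Finset.Icc (5 * (k / 6) - 3) (5 * (k / 6) + 6) := by
    refine Finset.inter_eq_right.2 fun j hj => ?_
    simp only [Finset.mem_Ico, Finset.mem_Icc] at hj hk ⊢
    omega
  rw [truncSum_eq_sum_inter ht.1 hx, hI, ← sub_zero (Finset.sum _ _),
    ← sum_nullCoeff_mul_hat ht k, ← Finset.sum_sub_distrib]
  refine (Finset.abs_sum_le_sum_abs _ _).trans ?_
  refine (Finset.sum_le_card_nsmul _ _ (5 / 3 * x) fun j _ => ?_).trans ?_
  · rw [← mul_sub, abs_mul]
    refine mul_le_mul (abs_nullCoeff_le j) ((abs_hat_sub_le _ _).trans (le_of_eq ?_))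
      (abs_nonneg _) (by norm_num)
    ring_nf
    exact abs_of_nonneg hx.1
  · have h : (5 * (k / 6) + 6 + 1 - (5 * (k / 6) - 3)).toNat = 10 := by omega
    rw [Int.card_Icc, h, nsmul_eq_mul]
    push_cast
    linarith [hx.1]

theorem sum_sq_nullCoeff_ge (N : ℕ) :
    (N : ℝ) ≤ ∑ j ∈ Finset.Ico (0 : ℤ) (5 * N), nullCoeff j ^ 2 := by
  -- The indices `5 u + 1` with `u < N` alone contribute `N`.
  have hinj : Function.Injective fun u : ℕ => 5 * (u : ℤ) + 1 := fun u v h => by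
    simpa using h
  have hsub : (Finset.range N).map ⟨_, hinj⟩ ⊆ Finset.Ico (0 : ℤ) (5 * N) := by
    intro j hj
    simp only [Finset.mem_map, Finset.mem_range, Function.Embedding.coeFn_mk] at hj
    obtain ⟨u, hu, rfl⟩ := hj
    rw [Finset.mem_Ico]
    omega
  refine le_trans (le_of_eq ?_)
    (Finset.sum_le_sum_of_subset_of_nonneg hsub fun j _ _ => sq_nonneg _)
  simp only [Finset.sum_map, Function.Embedding.coeFn_mk, nullCoeff_add_five_mul]
  simp [nullCoeff]

/-! ### Parseval's identity for a single translate -/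

/-- Parseval's identity on `[0, t]` for a function supported in `[0, δ]`, at the frequencies
`m / t`. -/
theorem hasSum_norm_integral_exp_mul_sq {t δ : ℝ} (hδ : 0 ≤ δ) (ht : 0 < t) (hδt : δ ≤ t)
    {H : ℝ → ℝ} (hH : Continuous H) :
    HasSum (fun m : ℤ => ‖∫ x in (0 : ℝ)..δ,
      Complex.exp (2 * Real.pi * Complex.I * (t⁻¹ : ℝ) * m * x) * (H x : ℂ)‖ ^ 2)
      (t * ∫ x in (0 : ℝ)..δ, H x ^ 2) := by
  set f : ℝ → ℂ := (Set.Ioc 0 δ).indicator fun x => (H x : ℂ) with hf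
  have hc : Continuous fun x => (H x : ℂ) := Complex.continuous_ofReal.comp hH
  have hfL : MemLp f 2 (volume.restrict (Set.Ioc 0 t)) := by
    refine MemLp.indicator measurableSet_Ioc ?_
    obtain ⟨C, hC⟩ := (isCompact_Icc (a := (0 : ℝ)) (b := t)).exists_bound_of_continuousOn
      hc.continuousOn
    refine MemLp.of_bound hc.aestronglyMeasurable C ?_
    exact (ae_restrict_iff' measurableSet_Ioc).2
      (Filter.Eventually.of_forall fun x hx => hC x ⟨hx.1.le, hx.2⟩)
  have hint {E : Type} [NormedAddCommGroup E] [NormedSpace ℝ E] (g : ℝ → E) :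
      ∫ x in (0 : ℝ)..t, (Set.Ioc 0 δ).indicator g x = ∫ x in (0 : ℝ)..δ, g x := by
    rw [intervalIntegral.integral_of_le ht.le, intervalIntegral.integral_of_le hδ,
      setIntegral_indicator measurableSet_Ioc,
      Set.inter_eq_right.2 (Set.Ioc_subset_Ioc_right hδt)]
  have h := ((hasSum_sq_fourierCoeffOn ht hfL).mul_left (t ^ 2))
  -- Fourier coefficients carry `exp (-2π i m x / t)`, hence the reflection `m ↦ -m`.
  rw [← (Equiv.neg ℤ).hasSum_iff] at h
  have hcoeff (m : ℤ) : fourierCoeffOn ht f (-m) = (1 / t) • ∫ x in (0 : ℝ)..δ,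
      Complex.exp (2 * Real.pi * Complex.I * (t⁻¹ : ℝ) * m * x) * (H x : ℂ) := by
    rw [fourierCoeffOn_eq_integral, sub_zero, neg_neg, ← hint]
    congr 1
    refine intervalIntegral.integral_congr fun x _ => ?_
    by_cases hx : x ∈ Set.Ioc 0 δ
    · simp only [hf, Set.indicator_of_mem hx, fourier_coe_apply, smul_eq_mul]
      push_cast
      congr 2
      field_simp
    · simp [hf, Set.indicator_of_notMem hx]
  have hnorm : ∫ x in (0 : ℝ)..t, ‖f x‖ ^ 2 = ∫ x in (0 : ℝ)..δ, H x ^ 2 := by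
    rw [← hint]
    refine intervalIntegral.integral_congr fun x _ => ?_
    by_cases hx : x ∈ Set.Ioc 0 δ
    · simp [hf, Set.indicator_of_mem hx]
    · simp [hf, Set.indicator_of_notMem hx]
  have hval : t ^ 2 * (t - 0)⁻¹ • ∫ x in (0 : ℝ)..t, ‖f x‖ ^ 2
      = t * ∫ x in (0 : ℝ)..δ, H x ^ 2 := by
    rw [hnorm, sub_zero, smul_eq_mul]
    field_simp
  rw [hval] at h
  refine h.congr_fun fun m => ?_
  simp only [Function.comp_apply, Equiv.neg_apply, hcoeff, norm_smul, mul_pow]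
  rw [Real.norm_of_nonneg (by positivity), ← mul_assoc, ← mul_pow, mul_one_div_cancel ht.ne',
    one_pow, one_mul]

/-! ### The test functions -/

/-- The step function that takes the value `nullCoeff j` on the interval `(j t, j t + δ]` for each
`0 ≤ j < 5 N`, as an element of `L²(ℝ)`. -/
noncomputable def testFun (N : ℕ) (t δ : ℝ) : Lp ℂ 2 (volume : Measure ℝ) :=
  ∑ j ∈ Finset.Ico (0 : ℤ) (5 * N), (nullCoeff j : ℂ) •
    indicatorConstLp 2 (measurableSet_Ioc (a := (j * t : ℝ)) (b := j * t + δ))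
      measure_Ioc_lt_top.ne 1

theorem norm_testFun_sq (N : ℕ) {t δ : ℝ} (hδ : 0 ≤ δ) (hδt : δ ≤ t) :
    ‖testFun N t δ‖ ^ 2 = (∑ j ∈ Finset.Ico (0 : ℤ) (5 * N), nullCoeff j ^ 2) * δ := by
  have hdisj (i j : ℤ) (hij : i ≠ j) :
      Set.Ioc (i * t : ℝ) (i * t + δ) ∩ Set.Ioc (j * t : ℝ) (j * t + δ) = ∅ := by
    ext x
    simp only [Set.mem_inter_iff, Set.mem_Ioc, Set.mem_empty_iff_false, iff_false]
    rintro ⟨⟨h₁, h₂⟩, h₃, h₄⟩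
    have ht : 0 ≤ t := hδ.trans hδt
    rcases lt_or_gt_of_ne hij with h | h
    · have h : (i + 1 : ℝ) ≤ j := by exact_mod_cast h
      nlinarith
    · have h : (j + 1 : ℝ) ≤ i := by exact_mod_cast h
      nlinarith
  have h : inner ℂ (testFun N t δ) (testFun N t δ)
      = (((∑ j ∈ Finset.Ico (0 : ℤ) (5 * N), nullCoeff j ^ 2) * δ : ℝ) : ℂ) := by
    rw [testFun, sum_inner, Finset.sum_mul, Complex.ofReal_sum]
    refine Finset.sum_congr rfl fun i hi => ?_
    rw [inner_sum, Finset.sum_eq_single_of_mem i hi]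
    · rw [inner_smul_left, inner_smul_right, L2.inner_indicatorConstLp_one_indicatorConstLp_one
          measurableSet_Ioc measurableSet_Ioc measure_Ioc_lt_top.ne measure_Ioc_lt_top.ne,
        Set.inter_self, Real.volume_real_Ioc_of_le (by linarith)]
      simp only [Complex.conj_ofReal, add_sub_cancel_left, RCLike.ofReal_eq_complex_ofReal]
      push_cast
      ring
    · intro j _ hji
      rw [inner_smul_left, inner_smul_right, L2.inner_indicatorConstLp_one_indicatorConstLp_one
          measurableSet_Ioc measurableSet_Ioc measure_Ioc_lt_top.ne measure_Ioc_lt_top.ne,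
        hdisj i j hji.symm]
      simp
  rw [@norm_sq_eq_re_inner ℂ, h]
  rfl

/-- Since the modulations are `1/b`-periodic, all steps of the test function can be moved to
`(0, δ]`, where the translates of the window add up to `truncSum`. The window `g` is kept as a
variable equal to `hat` because the proof that it belongs to `L²(ℝ)` occurs in the Gabor system. -/
theorem inner_testFun_gaborSystem {g : ℝ → ℝ} (hg : MemLp (fun x => (g x : ℂ)) 2 volume)
    (hg' : g = hat) {a b : ℝ} (hb : 0 < b) (hab : a * b = 5 / 6) (N : ℕ) {δ : ℝ} (hδ : 0 ≤ δ)
    (k m : ℤ) :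
    inner ℂ (testFun N b⁻¹ δ) (gaborSystem (fun x => (g x : ℂ)) hg a b (k, m)) =
      ∫ x in (0 : ℝ)..δ, Complex.exp (2 * Real.pi * Complex.I * b * m * x)
        * (truncSum N b⁻¹ k x : ℂ) := by
  subst hg'
  have ha : a = 5 / 6 * b⁻¹ := by field_simp; linarith
  have hbC : (b : ℂ) ≠ 0 := by exact_mod_cast hb.ne'
  have hterm (j : ℤ) : inner ℂ (indicatorConstLp 2
      (measurableSet_Ioc (a := (j * b⁻¹ : ℝ)) (b := j * b⁻¹ + δ)) measure_Ioc_lt_top.ne (1 : ℂ))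
      (gaborSystem (fun x => (hat x : ℂ)) hg a b (k, m)) =
      ∫ x in (0 : ℝ)..δ, Complex.exp (2 * Real.pi * Complex.I * b * m * x)
        * (hat (x + j * b⁻¹ - 5 / 6 * b⁻¹ * k) : ℂ) := by
    have hae : gaborSystem (fun x => (hat x : ℂ)) hg a b (k, m) =ᵐ[volume]
        atom (fun x => (hat x : ℂ)) a b k m := (memLp_atom hg a b k m).coeFn_toLp
    rw [L2.inner_indicatorConstLp_one,
      setIntegral_congr_ae measurableSet_Ioc (hae.mono fun x hx _ => hx),
      ← intervalIntegral.integral_of_le (by linarith)]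
    have := intervalIntegral.integral_comp_add_right (a := 0) (b := δ)
      (atom (fun x => (hat x : ℂ)) a b k m) (j * b⁻¹)
    rw [zero_add, add_comm δ] at this
    rw [← this]
    refine intervalIntegral.integral_congr fun x _ => ?_
    have hexp : (2 * Real.pi * Complex.I * b * m * ((x + j * b⁻¹ : ℝ) : ℂ) : ℂ)
        = 2 * Real.pi * Complex.I * b * m * x + (m * j : ℤ) * (2 * Real.pi * Complex.I) := by
      push_cast
      field_simp
    simp only [atom, hexp, Complex.exp_add, Complex.exp_int_mul_two_pi_mul_I, mul_one, ha]
  rw [testFun, sum_inner]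
  simp only [inner_smul_left, hterm, Complex.conj_ofReal, ← intervalIntegral.integral_const_mul]
  rw [← intervalIntegral.integral_finsetSum]
  · refine intervalIntegral.integral_congr fun x _ => ?_
    simp only [truncSum, Complex.ofReal_sum, Complex.ofReal_mul, Finset.mul_sum]
    exact Finset.sum_congr rfl fun j _ => by ring
  · intro j _
    have := continuous_hat
    exact Continuous.intervalIntegrable (by fun_prop) _ _

/-! ### Failure of the lower frame bound -/

/-- With steps of length `δ = 1 / (b N)`, the `24` translates at the two ends of the test function
contribute at most `24 · 17² δ = 6936 δ`, and the fewer than `6 N` interior ones at most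
`6 N · (17 δ)² δ ≤ 867 δ`, since `δ ≤ 1 / N` and `N ≥ 2`. -/
theorem tsum_norm_inner_testFun_le {g : ℝ → ℝ} (hg : MemLp (fun x => (g x : ℂ)) 2 volume)
    (hg' : g = hat) {a b : ℝ} (hab : a * b = 5 / 6) (hb : b⁻¹ ∈ Set.Icc (3 / 8 : ℝ) (3 / 7))
    {N : ℕ} (hN : 2 ≤ N)
    (hs : Summable fun i : ℤ × ℤ =>
      ‖inner ℂ (gaborSystem (fun x => (g x : ℂ)) hg a b i) (testFun N b⁻¹ (b⁻¹ / N))‖ ^ 2) :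
    ∑' i : ℤ × ℤ,
      ‖inner ℂ (gaborSystem (fun x => (g x : ℂ)) hg a b i) (testFun N b⁻¹ (b⁻¹ / N))‖ ^ 2
        ≤ b⁻¹ / N * 7803 := by
  have ht : 0 < b⁻¹ := by linarith [hb.1]
  have ht1 : b⁻¹ ≤ 1 := by linarith [hb.2]
  have hb0 : 0 < b := inv_pos.1 ht
  have hN' : (2 : ℝ) ≤ N := by exact_mod_cast hN
  set t := b⁻¹ with htdef
  set δ := t / N with hδdef
  have hδ : 0 < δ := by positivity
  have hδt : δ ≤ t := div_le_self ht.le (by linarith)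
  have hδN : δ ≤ 1 / N := div_le_div_of_nonneg_right ht1 (by linarith)
  have hrow (k : ℤ) : ∑' m : ℤ,
      ‖inner ℂ (gaborSystem (fun x => (g x : ℂ)) hg a b (k, m)) (testFun N t δ)‖ ^ 2
        = t * ∫ x in (0 : ℝ)..δ, truncSum N t k x ^ 2 := by
    rw [← (hasSum_norm_integral_exp_mul_sq hδ.le ht hδt (continuous_truncSum N t k)).tsum_eq]
    refine tsum_congr fun m => ?_
    rw [norm_inner_symm, htdef, inner_testFun_gaborSystem hg hg' hb0 hab N hδ.le, inv_inv]
  have hbound (k : ℤ) {c : ℝ} (hc : ∀ x ∈ Set.Icc 0 δ, |truncSum N t k x| ≤ c) :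
      t * ∫ x in (0 : ℝ)..δ, truncSum N t k x ^ 2 ≤ δ * c ^ 2 := by
    have h := intervalIntegral.integral_mono_on (μ := volume)
      (f := fun x => truncSum N t k x ^ 2) (g := fun _ => c ^ 2) hδ.le
      (((continuous_truncSum N t k).pow 2).intervalIntegrable 0 δ)
      (continuous_const.intervalIntegrable 0 δ) fun x hx =>
        sq_le_sq' (abs_le.1 (hc x hx)).1 (abs_le.1 (hc x hx)).2
    rw [intervalIntegral.integral_const, smul_eq_mul, sub_zero] at h
    have h0 : 0 ≤ δ * c ^ 2 := by positivity
    nlinarith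
  have hmem {x : ℝ} (hx : x ∈ Set.Icc 0 δ) : x ∈ Set.Icc 0 t := ⟨hx.1, hx.2.trans hδt⟩
  rw [hs.tsum_prod]
  simp only [hrow]
  rw [tsum_eq_sum (s := Finset.Ico (-6 : ℤ) (6 * N + 6))]
  swap
  · intro k hk
    have h := hbound k (c := 0) fun x hx => by rw [truncSum_eq_zero hb.1 (hmem hx) hk, abs_zero]
    have h' : 0 ≤ ∫ x in (0 : ℝ)..δ, truncSum N t k x ^ 2 :=
      intervalIntegral.integral_nonneg hδ.le fun x _ => sq_nonneg _
    have h'' := mul_nonneg ht.le h'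
    linarith
  have hsub : Finset.Ico (6 : ℤ) (6 * N - 6) ⊆ Finset.Ico (-6 : ℤ) (6 * N + 6) :=
    Finset.Ico_subset_Ico (by norm_num) (by linarith)
  rw [← Finset.sum_sdiff hsub]
  have h₁ := Finset.sum_le_card_nsmul (Finset.Ico (-6 : ℤ) (6 * N + 6) \ Finset.Ico 6 (6 * N - 6))
    (fun k => t * ∫ x in (0 : ℝ)..δ, truncSum N t k x ^ 2) (δ * 17 ^ 2) fun k _ =>
      hbound k fun x hx => abs_truncSum_le hb.1 (hmem hx) k
  have h₂ := Finset.sum_le_card_nsmul (Finset.Ico (6 : ℤ) (6 * N - 6))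
    (fun k => t * ∫ x in (0 : ℝ)..δ, truncSum N t k x ^ 2) (δ * (17 * δ) ^ 2) fun k hk =>
      hbound k fun x hx => (abs_truncSum_le_mul hb (hmem hx) hk).trans (by linarith [hx.2])
  have hc₁ : (Finset.Ico (-6 : ℤ) (6 * N + 6) \ Finset.Ico 6 (6 * N - 6)).card = 24 := by
    rw [Finset.card_sdiff_of_subset hsub, Int.card_Ico, Int.card_Ico]
    omega
  have hc₂ : (Finset.Ico (6 : ℤ) (6 * N - 6)).card ≤ 6 * N := by
    rw [Int.card_Ico]
    omega
  have hc₂ : ((Finset.Ico (6 : ℤ) (6 * N - 6)).card : ℝ) ≤ 6 * N := by exact_mod_cast hc₂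
  rw [hc₁, nsmul_eq_mul] at h₁
  rw [nsmul_eq_mul] at h₂
  have h₃ : (6 * N : ℝ) * δ ^ 2 ≤ 3 := by
    have h4 : δ * N = t := by rw [hδdef]; field_simp
    have h5 : δ ≤ 1 / 2 := hδN.trans (one_div_le_one_div_of_le (by norm_num) hN')
    calc (6 * N : ℝ) * δ ^ 2 = 6 * (δ * N) * δ := by ring
      _ ≤ 6 * 1 * (1 / 2) := by rw [h4]; gcongr
      _ = 3 := by norm_num
  have h₄ : ((Finset.Ico (6 : ℤ) (6 * N - 6)).card : ℝ) * (δ * (17 * δ) ^ 2) ≤ δ * 867 := by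
    calc _ ≤ (6 * N : ℝ) * (δ * (17 * δ) ^ 2) := by gcongr
      _ = δ * (289 * (6 * N * δ ^ 2)) := by ring
      _ ≤ δ * (289 * 3) := by gcongr
      _ = δ * 867 := by norm_num
  push_cast at h₁
  linarith

/-- The frame sum of the test function is at most `7803 δ`, whereas its squared norm is at least
`N δ`; letting `N` grow rules out a positive lower frame bound. -/
theorem not_isFrame_gaborSystem {g : ℝ → ℝ} (hg : MemLp (fun x => (g x : ℂ)) 2 volume)
    (hg' : g = hat) {a b : ℝ} (hab : a * b = 5 / 6)
    (hb : b⁻¹ ∈ Set.Icc (3 / 8 : ℝ) (3 / 7)) :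
    ¬ IsFrame (gaborSystem (fun x => (g x : ℂ)) hg a b) := by
  rintro ⟨A, _, hA, -, h⟩
  obtain ⟨N, hN⟩ := exists_nat_gt (7803 / A)
  rw [div_lt_iff₀ hA] at hN
  have ht : 0 < b⁻¹ := by linarith [hb.1]
  have hM : (0 : ℝ) < (N + 2 : ℕ) := by positivity
  have hδ : 0 < b⁻¹ / (N + 2 : ℕ) := by positivity
  obtain ⟨hs, hlow, -⟩ := h (testFun (N + 2) b⁻¹ (b⁻¹ / (N + 2 : ℕ)))
  have hup := hlow.trans (tsum_norm_inner_testFun_le hg hg' hab hb (by omega) hs)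
  have hMge : (1 : ℝ) ≤ (N + 2 : ℕ) := by exact_mod_cast (by omega : 1 ≤ N + 2)
  rw [norm_testFun_sq _ hδ.le (div_le_self ht.le hMge)] at hup
  have h1 := mul_le_mul_of_nonneg_left
    (mul_le_mul_of_nonneg_right (sum_sq_nullCoeff_ge (N + 2)) hδ.le) hA.le
  have h2 : b⁻¹ / (N + 2 : ℕ) * (A * (N + 2 : ℕ)) ≤ b⁻¹ / (N + 2 : ℕ) * 7803 := by linarith
  have h3 := le_of_mul_le_mul_left h2 hδ
  push_cast at h3
  linarith

end GaborFrames

theorem theorem3p6 (a b : ℝ) (hab : a * b = 5 / 6) (hb : b ∈ Set.Icc (7 / 3 : ℝ) (8 / 3))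
    (Ψ : Matrix (Fin 5) (Fin 6) ℂ)
    (hΨ : Ψ = GaborFrames.zzMatrix (fun x => (GaborFrames.B 2 x : ℂ)) a b 5 6 0 0) :
    ¬ GaborFrames.IsFrame
        (GaborFrames.gaborSystem (fun x => (GaborFrames.B 2 x : ℂ)) (GaborFrames.memLp_B 2) a b) ∧
    Ψ.row 1 - Ψ.row 4 = (5 / 3 : ℂ) • (Ψ.row 2 - Ψ.row 3) ∧
    Ψ.rank < 5 ∧
    ¬ ∃ p q : ℕ, p.Coprime q ∧ a * b = p / q ∧ |b - round b| ≤ 1 / (2 * (q : ℝ)) := by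
  have hrel : Ψ.row 1 - Ψ.row 4 = (5 / 3 : ℂ) • (Ψ.row 2 - Ψ.row 3) := by
    subst hΨ
    simp only [GaborFrames.B_two]
    exact GaborFrames.zzMatrix_hat_row_relation hab hb
  refine ⟨GaborFrames.not_isFrame_gaborSystem _ (funext GaborFrames.B_two) hab
    (GaborFrames.inv_mem_Icc hb), hrel, GaborFrames.rank_lt_five_of_row_relation hrel,
    GaborFrames.not_exists_abs_sub_round_le hab hb⟩
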